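/- An exact category is an additive category with an exact structure in the sense of Quillen, i.e. a suitable class of kernel-cokernel pairs $(i,p)$, called conflations ($i$ an inflation, $p$ a deflation). It is Frobenius if it has enough (relative) projectives and enough (relative) injectives and these two classes of objects coincide. A functor between additive categories equipped with classes of conflations is exact if it is additive and sends conflations to conflations; an exact equivalence is an exact functor that is an equivalence and whose quasi-inverse is exact. For a full additive subcategory $\mathcal{X}$ of an additive category $\mathcal{A}$, let $\mathcal{A}/[\mathcal{X}]$ be the factor category modulo the ideal $[\mathcal{X}]$ of morphisms factoring through an object of $\mathcal{X}$, and $\pi_{\mathcal{X}}\colon\mathcal{A}\to\mathcal{A}/[\mathcal{X}]$ the canonical functor. The stable category of a Frobenius category $\mathcal{A}$ is $\underline{\mathcal{A}}=\mathcal{A}/[\mathcal{P}]$, where $\mathcal{P}$ is the full subcategory of projective (equivalently, injective) objects. Let $F\colon\mathcal{A}\to\mathcal{B}$ be an additive functor between Frobenius categories. - A full additive subcategory $\mathcal{F}\subseteq\mathcal{A}$ is removable if $\mathcal{F}\subseteq\mathcal{P}$ and $\pi_{\mathcal{F}}$ sends every conflation of $\mathcal{A}$ to a kernel-cokernel pair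 in $\mathcal{A}/[\mathcal{F}]$; then $\mathcal{A}/[\mathcal{F}]$ is equipped with the class of all composable pairs isomorphic to images under $\pi_{\mathcal{F}}$ of conflations of $\mathcal{A}$. - $F$ is a Frobenius quotient if $F=\bar{F}\circ\pi_{\mathcal{F}}$ for some removable subcategory $\mathcal{F}\subseteq\mathcal{A}$ and some exact equivalence $\bar{F}\colon\mathcal{A}/[\mathcal{F}]\to\mathcal{B}$. - $F$ is a pretriangle-equivalence if it is exact, sends projectives to projectives, and the induced functor $\underline{\mathcal{A}}\to\underline{\mathcal{B}}$ is an equivalence of categories. - $F$ is objective if every morphism $f$ in $\mathcal{A}$ with $F(f)=0$ factors through an object $K$ of $\mathcal{A}$ with $F(K)\simeq 0$. Theorem. An additive functor $F\colon\mathcal{A}\to\mathcal{B}$ between two Frobenius categories is a Frobenius quotient if and only if it is a pretriangle-equivalence, objective, full and dense (essentially surjective). -/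

import Mathlib

open CategoryTheory CategoryTheory.Limits

namespace FrobQuot

universe v v' u u'

/-! ### Ideals and factor categories -/

section FactorCategory

variable {C : Type u} [Category.{v} C]

/-- The morphism `f` factors through an object of the full subcategory `P`. -/
def FactorsThrough (P : ObjectProperty C) {X Y : C} (f : X ⟶ Y) : Prop :=
  ∃ (Z : C) (a : X ⟶ Z) (b : Z ⟶ Y), P Z ∧ a ≫ b = f

lemma FactorsThrough.comp_left {P : ObjectProperty C} {X Y Z : C} (h : X ⟶ Y) {f : Y ⟶ Z}
    (hf : FactorsThrough P f) : FactorsThrough P (h ≫ f) := by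
  obtain ⟨W, a, b, hW, rfl⟩ := hf
  exact ⟨W, h ≫ a, b, hW, by simp⟩

lemma FactorsThrough.comp_right {P : ObjectProperty C} {X Y Z : C} {f : X ⟶ Y} (h : Y ⟶ Z)
    (hf : FactorsThrough P f) : FactorsThrough P (f ≫ h) := by
  obtain ⟨W, a, b, hW, rfl⟩ := hf
  exact ⟨W, a, b ≫ h, hW, by simp⟩

variable [Preadditive C]

/-- A full additive subcategory: it contains a zero object, and a direct sum of any two of its
objects. -/
class IsAdditiveSubcategory (P : ObjectProperty C) : Prop where
  exists_zero : ∃ Z : C, IsZero Z ∧ P Z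
  exists_sum : ∀ X Y : C, P X → P Y → ∃ b : BinaryBicone X Y, Nonempty b.IsBilimit ∧ P b.pt

/-- Congruence modulo the ideal `[P]` of the morphisms factoring through `P`. -/
def idealRel (P : ObjectProperty C) : HomRel C :=
  fun _ _ f g => FactorsThrough P (f - g)

variable (P : ObjectProperty C)

lemma FactorsThrough.neg {P : ObjectProperty C} {X Y : C} {f : X ⟶ Y}
    (hf : FactorsThrough P f) : FactorsThrough P (-f) := by
  obtain ⟨W, a, b, hW, rfl⟩ := hf
  exact ⟨W, -a, b, hW, by simp⟩

lemma FactorsThrough.zero [IsAdditiveSubcategory P] (X Y : C) :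
    FactorsThrough P (0 : X ⟶ Y) := by
  obtain ⟨Z, -, hZ⟩ := IsAdditiveSubcategory.exists_zero (P := P)
  exact ⟨Z, 0, 0, hZ, by simp⟩

lemma FactorsThrough.add {P : ObjectProperty C} [IsAdditiveSubcategory P] {X Y : C}
    {f g : X ⟶ Y} (hf : FactorsThrough P f) (hg : FactorsThrough P g) :
    FactorsThrough P (f + g) := by
  obtain ⟨W, a, b, hW, rfl⟩ := hf
  obtain ⟨W', a', b', hW', rfl⟩ := hg
  obtain ⟨s, -, hs⟩ := IsAdditiveSubcategory.exists_sum (P := P) W W' hW hW'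
  exact ⟨s.pt, a ≫ s.inl + a' ≫ s.inr, s.fst ≫ b + s.snd ≫ b', hs, by simp⟩

instance idealRel_congruence [IsAdditiveSubcategory P] : Congruence (idealRel P) where
  comp_left f g g' h := by
    have := FactorsThrough.comp_left f h
    rwa [Preadditive.comp_sub] at this
  comp_right g h := by
    have := FactorsThrough.comp_right g h
    rwa [Preadditive.sub_comp] at this
  equivalence :=
    { refl := fun f => by
        simpa [idealRel] using FactorsThrough.zero P _ _
      symm := fun h => by
        simpa [idealRel] using FactorsThrough.neg h
      trans := fun h h' => by
        simpa [idealRel] using FactorsThrough.add h h' }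

lemma idealRel_add [IsAdditiveSubcategory P] ⦃X Y : C⦄ (f₁ f₂ g₁ g₂ : X ⟶ Y)
    (hf : idealRel P f₁ f₂) (hg : idealRel P g₁ g₂) : idealRel P (f₁ + g₁) (f₂ + g₂) := by
  have := FactorsThrough.add hf hg
  rwa [sub_add_sub_comm] at this

/-- The factor category `C/[P]`. -/
abbrev Factor : Type u := CategoryTheory.Quotient (idealRel P)

/-- The canonical functor `π_P : C ⥤ C/[P]`. -/
abbrev proj : C ⥤ Factor P := CategoryTheory.Quotient.functor (idealRel P)

instance factorPreadditive [IsAdditiveSubcategory P] : Preadditive (Factor P) :=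
  CategoryTheory.Quotient.preadditive (idealRel P) (idealRel_add P)

instance proj_isAdditive [IsAdditiveSubcategory P] : (proj P).Additive :=
  CategoryTheory.Quotient.functor_additive (idealRel P) (idealRel_add P)

end FactorCategory

/-! ### Exact categories -/

/-- A composable pair `(f, g)` such that `f` is a kernel of `g` and `g` is a cokernel of `f`. -/
def IsKernelCokernelPair {C : Type u} [Category.{v} C] [Preadditive C] (S : ShortComplex C) :
    Prop :=
  Nonempty (IsLimit (KernelFork.ofι S.f S.zero)) ∧
    Nonempty (IsColimit (CokernelCofork.ofπ S.g S.zero))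

/-- `f` is the first morphism of a pair in the class `E`. -/
def IsInflation {C : Type u} [Category.{v} C] [Preadditive C]
    (E : ObjectProperty (ShortComplex C)) {X Y : C} (f : X ⟶ Y) : Prop :=
  ∃ (Z : C) (g : Y ⟶ Z) (w : f ≫ g = 0), E (ShortComplex.mk f g w)

/-- `g` is the second morphism of a pair in the class `E`. -/
def IsDeflation {C : Type u} [Category.{v} C] [Preadditive C]
    (E : ObjectProperty (ShortComplex C)) {Y Z : C} (g : Y ⟶ Z) : Prop :=
  ∃ (X : C) (f : X ⟶ Y) (w : f ≫ g = 0), E (ShortComplex.mk f g w)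

/-- An exact structure in the sense of Quillen on an additive category: a class of
kernel-cokernel pairs (the conflations), closed under isomorphisms, such that inflations and
deflations contain the identities, are closed under composition, and are stable under pushout,
respectively pullback, along arbitrary morphisms. -/
structure ExactStructure (C : Type u) [Category.{v} C] [Preadditive C] where
  /-- The class of conflations. -/
  conflation : ObjectProperty (ShortComplex C)
  isKernelCokernelPair : ∀ S, conflation S → IsKernelCokernelPair S
  of_iso : ∀ S T : ShortComplex C, Nonempty (S ≅ T) → conflation S → conflation T
  inflation_id : ∀ X : C, IsInflation conflation (𝟙 X)
  deflation_id : ∀ X : C, IsDeflation conflation (𝟙 X)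
  inflation_comp : ∀ {X Y Z : C} (f : X ⟶ Y) (g : Y ⟶ Z),
    IsInflation conflation f → IsInflation conflation g → IsInflation conflation (f ≫ g)
  deflation_comp : ∀ {X Y Z : C} (f : X ⟶ Y) (g : Y ⟶ Z),
    IsDeflation conflation f → IsDeflation conflation g → IsDeflation conflation (f ≫ g)
  inflation_pushout : ∀ {X Y X' : C} (i : X ⟶ Y) (a : X ⟶ X'), IsInflation conflation i →
    ∃ (Y' : C) (a' : Y ⟶ Y') (i' : X' ⟶ Y'), IsPushout i a a' i' ∧ IsInflation conflation i'
  deflation_pullback : ∀ {Y Z Z' : C} (p : Y ⟶ Z) (c : Z' ⟶ Z), IsDeflation conflation p →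
    ∃ (Y' : C) (c' : Y' ⟶ Y) (p' : Y' ⟶ Z'), IsPullback c' p' p c ∧ IsDeflation conflation p'

namespace ExactStructure

variable {C : Type u} [Category.{v} C] [Preadditive C] (E : ExactStructure C)

/-- The objects that are projective relative to the deflations. -/
def projective : ObjectProperty C := fun P =>
  ∀ ⦃Y Z : C⦄ (p : Y ⟶ Z), IsDeflation E.conflation p →
    ∀ f : P ⟶ Z, ∃ g : P ⟶ Y, g ≫ p = f

/-- The objects that are injective relative to the inflations. -/
def injective : ObjectProperty C := fun I =>
  ∀ ⦃X Y : C⦄ (i : X ⟶ Y), IsInflation E.conflation i →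
    ∀ f : X ⟶ I, ∃ g : Y ⟶ I, i ≫ g = f

/-- The exact category is Frobenius. -/
structure IsFrobenius : Prop where
  enough_projectives : ∀ X : C, ∃ (P : C) (p : P ⟶ X), E.projective P ∧ IsDeflation E.conflation p
  enough_injectives : ∀ X : C, ∃ (I : C) (i : X ⟶ I), E.injective I ∧ IsInflation E.conflation i
  projective_iff_injective : ∀ X : C, E.projective X ↔ E.injective X

instance projective_isAdditiveSubcategory [HasFiniteBiproducts C] :
    IsAdditiveSubcategory E.projective where
  exists_zero := by
    obtain ⟨O, hO⟩ := (hasZeroObject_of_hasFiniteBiproducts C).zero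
    exact ⟨O, hO, fun Y Z p _ f => ⟨0, hO.eq_of_src _ _⟩⟩
  exists_sum X Y hX hY := by
    have : HasBinaryBiproducts C := hasBinaryBiproducts_of_finite_biproducts C
    refine ⟨BinaryBiproduct.bicone X Y, ⟨BinaryBiproduct.isBilimit X Y⟩, ?_⟩
    intro V W p hp f
    obtain ⟨a, ha⟩ := hX p hp (biprod.inl ≫ f)
    obtain ⟨b, hb⟩ := hY p hp (biprod.inr ≫ f)
    exact ⟨biprod.desc a b, by apply biprod.hom_ext' <;> simp [ha, hb]⟩

/-- The stable category: the factor category modulo the ideal of the morphisms that factor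
through projectives. -/
abbrev Stable : Type u := Factor E.projective

end ExactStructure

/-! ### Functors -/

section Functors

variable {C : Type u} [Category.{v} C] [Preadditive C]
  {D : Type u'} [Category.{v'} D] [Preadditive D]

/-- Exactness of a functor relative to given classes of conflations: conflations are sent to
conflations. -/
def IsExact (EC : ObjectProperty (ShortComplex C)) (ED : ObjectProperty (ShortComplex D))
    (F : C ⥤ D) [F.PreservesZeroMorphisms] : Prop :=
  ∀ S : ShortComplex C, EC S → ED (S.map F)

/-- An additive equivalence of categories which is exact and whose quasi-inverse is exact. -/
def IsExactEquivalence (EC : ObjectProperty (ShortComplex C))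
    (ED : ObjectProperty (ShortComplex D)) (F : C ⥤ D) : Prop :=
  ∃ (_ : F.Additive) (_ : F.IsEquivalence), IsExact EC ED F ∧ IsExact ED EC F.inv

/-- The essential kernel of a functor: the objects annihilated by it. -/
def essKernel (F : C ⥤ D) : ObjectProperty C := fun X => IsZero (F.obj X)

/-- Every morphism annihilated by the functor factors through its essential kernel. -/
def IsObjective (F : C ⥤ D) : Prop :=
  ∀ ⦃X Y : C⦄ (f : X ⟶ Y), F.map f = 0 → FactorsThrough (essKernel F) f

/-- The functor between the stable categories that is induced by an additive functor sending
projectives to projectives. -/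
def stableFunctor (EC : ExactStructure C) (ED : ExactStructure D) (F : C ⥤ D) [F.Additive]
    (hF : ∀ X, EC.projective X → ED.projective (F.obj X)) : EC.Stable ⥤ ED.Stable :=
  CategoryTheory.Quotient.lift (idealRel EC.projective) (F ⋙ proj ED.projective) (by
    rintro X Y f g ⟨Z, a, b, hZ, h⟩
    refine CategoryTheory.Quotient.sound _ ⟨F.obj Z, F.map a, F.map b, hF Z hZ, ?_⟩
    rw [← F.map_comp, h, F.map_sub])

/-- A pretriangle-equivalence: an exact functor sending projectives to projectives such that the
induced functor between the stable categories is an equivalence. -/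
structure IsPretriangleEquivalence (EC : ExactStructure C) (ED : ExactStructure D) (F : C ⥤ D)
    [F.Additive] : Prop where
  exact : IsExact EC.conflation ED.conflation F
  map_projective : ∀ X, EC.projective X → ED.projective (F.obj X)
  isEquivalence : (stableFunctor EC ED F map_projective).IsEquivalence

/-- The isomorphism closure in `C/[P]` of the image of the class of conflations under `π_P`. -/
def factorConflation (E : ExactStructure C) (P : ObjectProperty C) [IsAdditiveSubcategory P] :
    ObjectProperty (ShortComplex (Factor P)) := fun S =>
  ∃ T : ShortComplex C, E.conflation T ∧ Nonempty (T.map (proj P) ≅ S)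

/-- A removable subcategory: a full additive subcategory consisting of projectives such that
`π_P` sends conflations to kernel-cokernel pairs. -/
structure IsRemovable (E : ExactStructure C) (P : ObjectProperty C) [IsAdditiveSubcategory P] :
    Prop where
  le_projective : P ≤ E.projective
  isKernelCokernelPair : ∀ S, E.conflation S → IsKernelCokernelPair (S.map (proj P))

/-- A Frobenius quotient: a functor that factors as `π_P` for a removable subcategory `P`,
followed by an exact equivalence from `C/[P]`, whose conflations are those isomorphic to images of
conflations of `C`. -/
def IsFrobeniusQuotient (EC : ExactStructure C) (ED : ExactStructure D) (F : C ⥤ D) : Prop :=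
  ∃ (P : ObjectProperty C) (_ : IsAdditiveSubcategory P) (G : Factor P ⥤ D),
    IsRemovable EC P ∧ proj P ⋙ G = F ∧
      IsExactEquivalence (factorConflation EC P) ED.conflation G

end Functors

end FrobQuot

namespace FrobQuot

universe w w' t t'

/-! ### Conflations -/

namespace ExactStructure

variable {C : Type t} [Category.{w} C] [Preadditive C] (E : ExactStructure C)

/-! The pivot in both directions is that every conflation of the target is, up to isomorphism, the
image of a conflation of the source. For a Frobenius quotient this is the exactness of the
quasi-inverse. It makes `F` preserve projectives, and the induced stable functor inherits fullness
and density from `F`. It is faithful because morphisms killed by `F` factor through the removable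
subcategory, hence through projectives (`stableFunctor_faithful`). Conversely, take the essential
kernel as the removable subcategory. Objectivity, fullness and density make the induced functor on
the factor category an equivalence, and stable faithfulness makes the essential kernel consist of
projectives. Exactness of `F`, reflected by the equivalence, gives the kernel-cokernel pairs. What
remains is exactness of the quasi-inverse, that is, the lifting of conflations
(`exists_map_conflation_iso`). A conflation ending in `Z` is a pushout of a projective presentation
of `Z`, so it suffices to lift the morphism along which one pushes out. -/

lemma conflation_of_iso {S T : ShortComplex C} (hS : E.conflation S) (e : S ≅ T) :
    E.conflation T :=
  E.of_iso S T ⟨e⟩ hS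

variable {E} in
lemma mono_of_conflation {X Y Z : C} {f : X ⟶ Y} {g : Y ⟶ Z} {w : f ≫ g = 0}
    (h : E.conflation (ShortComplex.mk f g w)) : Mono f := by
  obtain ⟨⟨hf⟩, -⟩ := E.isKernelCokernelPair _ h
  exact mono_of_isLimit_fork hf

variable {E} in
lemma epi_of_conflation {X Y Z : C} {f : X ⟶ Y} {g : Y ⟶ Z} {w : f ≫ g = 0}
    (h : E.conflation (ShortComplex.mk f g w)) : Epi g := by
  obtain ⟨-, ⟨hg⟩⟩ := E.isKernelCokernelPair _ h
  exact epi_of_isColimit_cofork hg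

variable {E} in
lemma exists_lift_of_conflation {X Y Z : C} {f : X ⟶ Y} {g : Y ⟶ Z} {w : f ≫ g = 0}
    (h : E.conflation (ShortComplex.mk f g w)) {T : C} (t : T ⟶ Y) (ht : t ≫ g = 0) :
    ∃ m : T ⟶ X, m ≫ f = t := by
  obtain ⟨⟨hf⟩, -⟩ := E.isKernelCokernelPair _ h
  obtain ⟨m, hm⟩ := KernelFork.IsLimit.lift' hf t ht
  exact ⟨m, hm⟩

variable {E} in
lemma exists_desc_of_conflation {X Y Z : C} {f : X ⟶ Y} {g : Y ⟶ Z} {w : f ≫ g = 0}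
    (h : E.conflation (ShortComplex.mk f g w)) {T : C} (t : Y ⟶ T) (ht : f ≫ t = 0) :
    ∃ m : Z ⟶ T, g ≫ m = t := by
  obtain ⟨-, ⟨hg⟩⟩ := E.isKernelCokernelPair _ h
  obtain ⟨m, hm⟩ := CokernelCofork.IsColimit.desc' hg t ht
  exact ⟨m, hm⟩

lemma isDeflation_iso_comp {Y Y' Z : C} (e : Y ≅ Y') {p : Y' ⟶ Z}
    (hp : IsDeflation E.conflation p) : IsDeflation E.conflation (e.hom ≫ p) := by
  obtain ⟨X, f, w, h⟩ := hp
  exact ⟨X, f ≫ e.inv, by simp [w], E.conflation_of_iso h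
    (ShortComplex.isoMk (Iso.refl _) e.symm (Iso.refl _) (by simp) (by simp))⟩

lemma isDeflation_of_isPullback {Y Z Y' Z' : C} {c' : Y' ⟶ Y} {p' : Y' ⟶ Z'} {p : Y ⟶ Z}
    {c : Z' ⟶ Z} (sq : IsPullback c' p' p c) (hp : IsDeflation E.conflation p) :
    IsDeflation E.conflation p' := by
  obtain ⟨V, a, b, sq', hb⟩ := E.deflation_pullback p c hp
  have := E.isDeflation_iso_comp (sq.isoIsPullback _ _ sq') hb
  rwa [IsPullback.isoIsPullback_hom_snd] at this

/-- Kernels are unique up to isomorphism, so `f` may replace the inflation that comes with `g`. -/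
lemma conflation_of_isDeflation {X Y Z : C} {f : X ⟶ Y} {g : Y ⟶ Z} (w : f ≫ g = 0) [Mono f]
    (hg : IsDeflation E.conflation g)
    (hf : ∀ ⦃T : C⦄ (t : T ⟶ Y), t ≫ g = 0 → ∃ m : T ⟶ X, m ≫ f = t) :
    E.conflation (ShortComplex.mk f g w) := by
  obtain ⟨X', f', w', h⟩ := hg
  have := mono_of_conflation h
  obtain ⟨a, ha⟩ := exists_lift_of_conflation h f w
  obtain ⟨b, hb⟩ := hf f' w'
  let e : X' ≅ X := ⟨b, a, by rw [← cancel_mono f']; simp [ha, hb],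
    by rw [← cancel_mono f]; simp [ha, hb]⟩
  exact E.conflation_of_iso h
    (ShortComplex.isoMk e (Iso.refl _) (Iso.refl _) (by simpa [e] using hb) (by simp))

lemma conflation_of_isInflation {X Y Z : C} {f : X ⟶ Y} {g : Y ⟶ Z} (w : f ≫ g = 0) [Epi g]
    (hf : IsInflation E.conflation f)
    (hg : ∀ ⦃T : C⦄ (t : Y ⟶ T), f ≫ t = 0 → ∃ m : Z ⟶ T, g ≫ m = t) :
    E.conflation (ShortComplex.mk f g w) := by
  obtain ⟨Z', g', w', h⟩ := hf
  have := epi_of_conflation h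
  obtain ⟨a, ha⟩ := exists_desc_of_conflation h g w
  obtain ⟨b, hb⟩ := hg g' w'
  let e : Z' ≅ Z := ⟨a, b, by rw [← cancel_epi g']; simp [reassoc_of% ha, hb],
    by rw [← cancel_epi g]; simp [ha, reassoc_of% hb]⟩
  exact E.conflation_of_iso h
    (ShortComplex.isoMk (Iso.refl _) (Iso.refl _) e (by simp) (by simpa [e] using ha.symm))

/-- In a morphism of conflations that is the identity on the cokernels, the square of the
inflations is a pushout. -/
lemma isPushout_of_conflation [HasFiniteBiproducts C] {K Q X Y Z : C} {k : K ⟶ Q} {p : Q ⟶ Z}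
    {w : k ≫ p = 0} (hkp : E.conflation (ShortComplex.mk k p w)) {i : X ⟶ Y} {g : Y ⟶ Z}
    {w' : i ≫ g = 0} (hig : E.conflation (ShortComplex.mk i g w')) {h : Q ⟶ Y} (hh : h ≫ g = p)
    {γ : K ⟶ X} (hγ : γ ≫ i = k ≫ h) : IsPushout k γ h i := by
  have : HasBinaryBiproducts C := hasBinaryBiproducts_of_finite_biproducts C
  have := mono_of_conflation hkp
  have := mono_of_conflation hig
  -- The fibre product of `p` and `g` is `X ⊞ Q`, since `h` splits off the kernel `X` of `g`; hence
  -- `(i, h)` is a deflation, being a base change of `p`.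
  have sq : IsPullback (biprod.snd : X ⊞ Q ⟶ Q) (biprod.desc i h) p g := by
    have H (s : PullbackCone p g) : ∃ m : s.pt ⟶ X, m ≫ i = s.snd - s.fst ≫ h :=
      exists_lift_of_conflation hig _ (by simp [hh, s.condition])
    choose m hm using H
    refine ⟨⟨by apply biprod.hom_ext' <;> simp [w', hh]⟩, ⟨PullbackCone.IsLimit.mk _
      (fun s => biprod.lift (m s) s.fst) (fun s => by simp)
      (fun s => by simp [biprod.lift_desc, hm]) (fun s l h₁ h₂ => ?_)⟩⟩
    apply biprod.hom_ext
    · rw [← cancel_mono i, biprod.lift_fst, hm, ← h₁, ← h₂, biprod.desc_eq]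
      simp
    · simpa using h₁
  have hq := E.isDeflation_of_isPullback sq ⟨_, _, _, hkp⟩
  have wκ : biprod.lift (-γ) k ≫ biprod.desc i h = 0 := by simp [biprod.lift_desc, hγ]
  have : Mono (biprod.lift (-γ) k) := mono_of_mono_fac (biprod.lift_snd (-γ) k)
  -- The kernel of `(i, h)` is `(-γ, k)`; that `(i, h)` is its cokernel is exactly the pushout
  -- property.
  have hκ := E.conflation_of_isDeflation wκ hq (fun T t ht => by
    obtain ⟨m, hm⟩ := exists_lift_of_conflation hkp (t ≫ biprod.snd) (by
      rw [Category.assoc, sq.w, reassoc_of% ht, zero_comp])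
    refine ⟨m, biprod.hom_ext _ _ ?_ (by simpa using hm)⟩
    rw [biprod.desc_eq, Preadditive.comp_add] at ht
    rw [← cancel_mono i]
    simp only [Category.assoc, biprod.lift_fst, Preadditive.neg_comp, Preadditive.comp_neg, hγ]
    rw [reassoc_of% hm]
    exact (eq_neg_of_add_eq_zero_left ht).symm)
  have := epi_of_conflation hκ
  have H (s : PushoutCocone k γ) : ∃ m : Y ⟶ s.pt, biprod.desc i h ≫ m = biprod.desc s.inr s.inl :=
    exists_desc_of_conflation hκ _ (by simp [biprod.lift_desc, s.condition])
  choose m hm using H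
  refine ⟨⟨hγ.symm⟩, ⟨PushoutCocone.IsColimit.mk _ m (fun s => ?_) (fun s => ?_)
    (fun s l h₁ h₂ => ?_)⟩⟩
  · simpa using biprod.inr ≫= hm s
  · simpa using biprod.inl ≫= hm s
  · rw [← cancel_epi (biprod.desc i h), hm]
    apply biprod.hom_ext' <;> simp [h₁, h₂]

/-- The pushout of a conflation along a morphism out of its first object. -/
lemma exists_conflation_pushout {K Q Z X : C} {k : K ⟶ Q} {p : Q ⟶ Z} {w : k ≫ p = 0}
    (hkp : E.conflation (ShortComplex.mk k p w)) (γ : K ⟶ X) :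
    ∃ (W : C) (h : Q ⟶ W) (i : X ⟶ W) (g : W ⟶ Z) (w' : i ≫ g = 0),
      γ ≫ i = k ≫ h ∧ h ≫ g = p ∧ E.conflation (ShortComplex.mk i g w') := by
  obtain ⟨W, h, i, sq, hi⟩ := E.inflation_pushout k γ ⟨_, _, _, hkp⟩
  have := epi_of_conflation hkp
  have hg : k ≫ p = γ ≫ (0 : X ⟶ Z) := by simp [w]
  have hp : h ≫ sq.desc p 0 hg = p := sq.inl_desc _ _ _
  have : Epi (sq.desc p 0 hg) := epi_of_epi_fac hp
  refine ⟨W, h, i, sq.desc p 0 hg, sq.inr_desc _ _ _, sq.w.symm, hp,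
    E.conflation_of_isInflation _ hi fun T t ht => ?_⟩
  obtain ⟨m, hm⟩ := exists_desc_of_conflation hkp (h ≫ t) (by
    rw [reassoc_of% sq.w, ht, comp_zero])
  exact ⟨m, sq.hom_ext (by simpa using hm) (by simp [ht])⟩

lemma projective_of_factorsThrough {X : C} (h : FactorsThrough E.projective (𝟙 X)) :
    E.projective X := by
  obtain ⟨Q, a, b, hQ, hab⟩ := h
  intro Y Z p hp f
  obtain ⟨g, hg⟩ := hQ p hp (b ≫ f)
  exact ⟨a ≫ g, by rw [Category.assoc, hg, reassoc_of% hab]⟩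

end ExactStructure

lemma FactorsThrough.mono {C : Type t} [Category.{w} C] {P Q : ObjectProperty C} (h : P ≤ Q)
    {X Y : C} {f : X ⟶ Y} (hf : FactorsThrough P f) : FactorsThrough Q f := by
  obtain ⟨Z, a, b, hZ, hab⟩ := hf
  exact ⟨Z, a, b, h _ hZ, hab⟩

/-! ### Factor categories -/

section Factor

variable {C : Type t} [Category.{w} C] [Preadditive C] (P : ObjectProperty C)
  [IsAdditiveSubcategory P]

lemma proj_map_eq_iff {X Y : C} (f g : X ⟶ Y) :
    (proj P).map f = (proj P).map g ↔ FactorsThrough P (f - g) :=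
  CategoryTheory.Quotient.functor_map_eq_iff (idealRel P) f g

lemma proj_map_eq_zero_iff {X Y : C} (f : X ⟶ Y) :
    (proj P).map f = 0 ↔ FactorsThrough P f := by
  rw [← (proj P).map_zero X Y, proj_map_eq_iff, sub_zero]

lemma isZero_proj_obj {X : C} (hX : P X) : IsZero ((proj P).obj X) := by
  rw [IsZero.iff_id_eq_zero, ← (proj P).map_id, proj_map_eq_zero_iff]
  exact ⟨X, 𝟙 X, 𝟙 X, hX, by simp⟩

end Factor

/-! ### Functors -/

section Functors

variable {C : Type t} [Category.{w} C] [Preadditive C]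
  {D : Type t'} [Category.{w'} D] [Preadditive D]

lemma IsKernelCokernelPair.of_map {F : C ⥤ D} [F.PreservesZeroMorphisms] [F.IsEquivalence]
    {S : ShortComplex C} (h : IsKernelCokernelPair (S.map F)) : IsKernelCokernelPair S := by
  obtain ⟨⟨hf⟩, ⟨hg⟩⟩ := h
  exact ⟨⟨isLimitOfReflects F
      ((KernelFork.isLimitMapConeEquiv (KernelFork.ofι S.f S.zero) F).symm hf)⟩,
    ⟨isColimitOfReflects F
      ((CokernelCofork.isColimitMapCoconeEquiv (CokernelCofork.ofπ S.g S.zero) F).symm hg)⟩⟩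

instance essKernel_isAdditiveSubcategory [HasFiniteBiproducts C] (F : C ⥤ D) [F.Additive] :
    IsAdditiveSubcategory (essKernel F) where
  exists_zero := by
    obtain ⟨O, hO⟩ := (hasZeroObject_of_hasFiniteBiproducts C).zero
    exact ⟨O, hO, F.map_isZero hO⟩
  exists_sum X Y hX hY := by
    have : HasBinaryBiproducts C := hasBinaryBiproducts_of_finite_biproducts C
    refine ⟨BinaryBiproduct.bicone X Y, ⟨BinaryBiproduct.isBilimit X Y⟩, ?_⟩
    change IsZero (F.obj (X ⊞ Y))
    rw [IsZero.iff_id_eq_zero, ← F.map_id, ← biprod.total, F.map_add, F.map_comp, F.map_comp,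
      hX.eq_zero_of_tgt (F.map biprod.fst), hY.eq_zero_of_tgt (F.map biprod.snd)]
    simp

/-! ### Lifting conflations -/

lemma exists_map_conflation_iso [HasFiniteBiproducts D] {EC : ExactStructure C}
    (hC : EC.IsFrobenius) {ED : ExactStructure D} {F : C ⥤ D} [F.Additive]
    [F.Full] [F.EssSurj] (hF : IsExact EC.conflation ED.conflation F)
    (hP : ∀ X, EC.projective X → ED.projective (F.obj X))
    {S : ShortComplex D} (hS : ED.conflation S) :
    ∃ T : ShortComplex C, EC.conflation T ∧ Nonempty (T.map F ≅ S) := by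
  let eX := F.objObjPreimageIso S.X₁
  let eZ := F.objObjPreimageIso S.X₃
  obtain ⟨Q, p, hQ, K, k, w, hkp⟩ := hC.enough_projectives (F.objPreimage S.X₃)
  have hi : ED.conflation (ShortComplex.mk (eX.hom ≫ S.f) (S.g ≫ eZ.inv) (by simp)) :=
    ED.conflation_of_iso hS
      (ShortComplex.isoMk eX.symm (Iso.refl _) eZ.symm (by simp) (by simp))
  -- Projectivity of `F.obj Q` compares the image of the presentation with the given conflation; the
  -- induced map on kernels lifts by fullness.
  obtain ⟨h, hh⟩ := hP Q hQ _ ⟨_, _, _, hi⟩ (F.map p)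
  have hFkp : ED.conflation (ShortComplex.mk (F.map k) (F.map p) _) := hF _ hkp
  obtain ⟨γ', hγ'⟩ := ExactStructure.exists_lift_of_conflation hi (F.map k ≫ h) (by
    rw [Category.assoc, hh, ← F.map_comp, w, F.map_zero])
  obtain ⟨γ, rfl⟩ := F.map_surjective γ'
  obtain ⟨W, a, i, g, w', hγ, ha, hig⟩ := EC.exists_conflation_pushout hkp γ
  have hFig : ED.conflation (ShortComplex.mk (F.map i) (F.map g) _) := hF _ hig
  -- Both middle terms are pushouts of the same span `F.map k`, `F.map γ`, hence isomorphic.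
  have sq₁ := ED.isPushout_of_conflation hFkp hi hh hγ'
  have sq₂ := ED.isPushout_of_conflation (h := F.map a) (γ := F.map γ) hFkp hFig
    (by rw [← F.map_comp, ha]) (by rw [← F.map_comp, hγ, F.map_comp])
  let e : F.obj W ≅ S.X₂ := sq₂.isoIsPushout _ _ sq₁
  have he₁ : F.map a ≫ e.hom = h := sq₂.inl_isoIsPushout_hom _ _ sq₁
  have he₂ : F.map i ≫ e.hom = eX.hom ≫ S.f := sq₂.inr_isoIsPushout_hom _ _ sq₁
  have he₃ : e.hom ≫ S.g = F.map g ≫ eZ.hom := by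
    apply sq₂.hom_ext
    · rw [reassoc_of% he₁, ← F.map_comp_assoc, ha, ← hh]
      simp
    · rw [reassoc_of% he₂, ← F.map_comp_assoc, w']
      simp
  exact ⟨_, hig, ⟨ShortComplex.isoMk eX e eZ he₂.symm he₃⟩⟩

/-! ### The induced functor on stable categories -/

lemma stableFunctor_full {EC : ExactStructure C} {ED : ExactStructure D} {F : C ⥤ D} [F.Additive]
    [F.Full] (hP : ∀ X, EC.projective X → ED.projective (F.obj X)) :
    (stableFunctor EC ED F hP).Full where
  map_surjective {X Y} f := by
    obtain ⟨f, rfl⟩ := (proj ED.projective).map_surjective f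
    obtain ⟨f, rfl⟩ := F.map_surjective f
    exact ⟨(proj EC.projective).map f, rfl⟩

lemma stableFunctor_essSurj {EC : ExactStructure C} {ED : ExactStructure D} {F : C ⥤ D}
    [F.Additive] [F.EssSurj] (hP : ∀ X, EC.projective X → ED.projective (F.obj X)) :
    (stableFunctor EC ED F hP).EssSurj where
  mem_essImage Y :=
    ⟨(proj EC.projective).obj (F.objPreimage Y.as),
      ⟨(proj ED.projective).mapIso (F.objObjPreimageIso Y.as)⟩⟩

lemma stableFunctor_faithful [HasFiniteBiproducts C] [HasFiniteBiproducts D]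
    {EC : ExactStructure C} (hC : EC.IsFrobenius)
    {ED : ExactStructure D} {F : C ⥤ D} [F.Additive] [F.Full] [F.EssSurj]
    (hF : IsExact EC.conflation ED.conflation F)
    (hP : ∀ X, EC.projective X → ED.projective (F.obj X))
    (hker : ∀ ⦃X Y : C⦄ (f : X ⟶ Y), F.map f = 0 → FactorsThrough EC.projective f) :
    (stableFunctor EC ED F hP).Faithful where
  map_injective {X Y} f g hfg := by
    obtain ⟨f, rfl⟩ := (proj EC.projective).map_surjective f
    obtain ⟨g, rfl⟩ := (proj EC.projective).map_surjective g
    obtain ⟨Q, a, b, hQ, hab⟩ := (proj_map_eq_iff ED.projective (F.map f) (F.map g)).1 hfg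
    rw [proj_map_eq_iff]
    let e := F.objObjPreimageIso Q
    obtain ⟨a', ha'⟩ := F.map_surjective (a ≫ e.inv)
    obtain ⟨b', hb'⟩ := F.map_surjective (e.hom ≫ b)
    obtain ⟨R, p, hR, K, k, w, hkp⟩ := hC.enough_projectives (F.objPreimage Q)
    -- A preimage of `Q` need not be projective, so it is covered by a projective `R`. The image of
    -- the cover splits because `Q` is projective, so up to a morphism killed by `F` the difference
    -- `f - g` factors through `R`.
    obtain ⟨s, hs⟩ := hQ (F.map p ≫ e.hom) ⟨_, F.map k, by
      rw [← Category.assoc, ← F.map_comp, w]; simp, ED.conflation_of_iso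
        (hF _ hkp) (ShortComplex.isoMk (Iso.refl _) (Iso.refl _) e
          ((Category.id_comp _).trans (Category.comp_id _).symm) (Category.id_comp _))⟩ (𝟙 Q)
    obtain ⟨s', hs'⟩ := F.map_surjective (e.hom ≫ s)
    have h₁ : FactorsThrough EC.projective (f - g - a' ≫ (s' ≫ p) ≫ b') := by
      apply hker
      have hsp : F.map s' ≫ F.map p = 𝟙 _ := by
        rw [hs', ← cancel_mono e.hom]
        simp [hs]
      rw [F.map_sub, F.map_sub, ← hab, F.map_comp, F.map_comp, F.map_comp, hsp, ha', hb']
      simp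
    have h₂ : FactorsThrough EC.projective (a' ≫ (s' ≫ p) ≫ b') :=
      ⟨R, a' ≫ s', p ≫ b', hR, by simp⟩
    simpa using h₁.add h₂

/-! ### Frobenius quotients are pretriangle-equivalences -/

lemma map_projective_of_exists_conflation_iso {EC : ExactStructure C} {ED : ExactStructure D}
    {F : C ⥤ D} [F.Additive] [F.Full]
    (hlift : ∀ S, ED.conflation S → ∃ T, EC.conflation T ∧ Nonempty (T.map F ≅ S))
    (X : C) (hX : EC.projective X) : ED.projective (F.obj X) := by
  rintro Y Z p ⟨V, i, w, h⟩ f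
  -- Lifting problems against `p` become images of lifting problems against a deflation of `C`,
  -- solvable there by projectivity of `X`.
  obtain ⟨T, hT, ⟨e⟩⟩ := hlift _ h
  obtain ⟨a, b, c, hab, hc⟩ : ∃ (a : F.obj T.X₂ ⟶ Y) (b : F.obj T.X₃ ⟶ Z) (c : Z ⟶ F.obj T.X₃),
      a ≫ p = F.map T.g ≫ b ∧ c ≫ b = 𝟙 Z :=
    ⟨e.hom.τ₂, e.hom.τ₃, e.inv.τ₃, e.hom.comm₂₃, congrArg ShortComplex.Hom.τ₃ e.inv_hom_id⟩
  obtain ⟨f', hf'⟩ := F.map_surjective (f ≫ c)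
  obtain ⟨g, hg⟩ := hX T.g ⟨_, _, _, hT⟩ f'
  exact ⟨F.map g ≫ a, by
    rw [Category.assoc, hab, ← F.map_comp_assoc, hg, hf', Category.assoc, hc, Category.comp_id]⟩

lemma IsFrobeniusQuotient.exists_map_conflation_iso {EC : ExactStructure C}
    {ED : ExactStructure D} {P : ObjectProperty C} [IsAdditiveSubcategory P] {G : Factor P ⥤ D}
    [G.Additive] [G.IsEquivalence] (hG : IsExact ED.conflation (factorConflation EC P) G.inv)
    {S : ShortComplex D} (hS : ED.conflation S) :
    ∃ T, EC.conflation T ∧ Nonempty (T.map (proj P ⋙ G) ≅ S) := by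
  obtain ⟨T, hT, ⟨e⟩⟩ := hG S hS
  refine ⟨T, hT, ⟨G.mapShortComplex.mapIso e ≪≫ ?_⟩⟩
  exact S.mapNatIso G.asEquivalence.counitIso

lemma IsFrobeniusQuotient.isPretriangleEquivalence
    [HasFiniteBiproducts C] [HasFiniteBiproducts D] {EC : ExactStructure C} (hC : EC.IsFrobenius)
    {ED : ExactStructure D} {F : C ⥤ D} [F.Additive] (h : IsFrobeniusQuotient EC ED F) :
    IsPretriangleEquivalence EC ED F ∧ IsObjective F ∧ F.Full ∧ F.EssSurj := by
  obtain ⟨P, hP, G, hrem, rfl, hadd, heq, hG, hG'⟩ := h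
  have hfull : (proj P ⋙ G).Full := inferInstance
  have hess : (proj P ⋙ G).EssSurj := inferInstance
  have hker : ∀ ⦃X Y : C⦄ (f : X ⟶ Y), (proj P ⋙ G).map f = 0 → FactorsThrough P f := by
    intro X Y f hf
    rw [← proj_map_eq_zero_iff]
    exact G.map_injective (by rw [G.map_zero]; exact hf)
  have hexact : IsExact EC.conflation ED.conflation (proj P ⋙ G) :=
    fun S hS => hG _ ⟨S, hS, ⟨Iso.refl _⟩⟩
  have hproj := map_projective_of_exists_conflation_iso (EC := EC) (F := proj P ⋙ G)
    (fun S hS => IsFrobeniusQuotient.exists_map_conflation_iso hG' hS)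
  refine ⟨⟨hexact, hproj, ?_⟩, fun X Y f hf => (hker f hf).mono fun Z hZ =>
    G.map_isZero (isZero_proj_obj P hZ), hfull, hess⟩
  have := stableFunctor_full hproj
  have := stableFunctor_essSurj hproj
  have := stableFunctor_faithful hC hexact hproj
    fun X Y f hf => (hker f hf).mono hrem.le_projective
  exact { }

/-! ### Pretriangle-equivalences are Frobenius quotients -/

/-- By stable faithfulness the identity of `X` is stably zero, so `X` is a retract of a projective.
-/
lemma IsPretriangleEquivalence.projective_of_isZero [HasFiniteBiproducts C]
    {EC : ExactStructure C} {ED : ExactStructure D} {F : C ⥤ D} [F.Additive] (h : IsPretriangleEquivalence EC ED F)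
    {X : C} (hX : IsZero (F.obj X)) : EC.projective X := by
  have := h.isEquivalence
  apply EC.projective_of_factorsThrough
  rw [← sub_zero (𝟙 X), ← proj_map_eq_iff]
  apply (stableFunctor EC ED F h.map_projective).map_injective
  change (proj ED.projective).map (F.map (𝟙 X)) = (proj ED.projective).map (F.map 0)
  rw [hX.eq_of_src (F.map (𝟙 X)) (F.map 0)]

lemma IsPretriangleEquivalence.isFrobeniusQuotient
    [HasFiniteBiproducts C] [HasFiniteBiproducts D] {EC : ExactStructure C} (hC : EC.IsFrobenius)
    {ED : ExactStructure D} {F : C ⥤ D} [F.Additive] (h : IsPretriangleEquivalence EC ED F)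
    (hobj : IsObjective F) [F.Full] [F.EssSurj] : IsFrobeniusQuotient EC ED F := by
  let G : Factor (essKernel F) ⥤ D := CategoryTheory.Quotient.lift _ F (by
    rintro X Y f g ⟨Z, a, b, hZ, hab⟩
    rw [← sub_eq_zero, ← F.map_sub, ← hab, F.map_comp, hZ.eq_zero_of_tgt (F.map a), zero_comp])
  have hGF : proj (essKernel F) ⋙ G = F := CategoryTheory.Quotient.lift_spec _ _ _
  have hadd : G.Additive := ⟨fun {X Y f g} => by
    obtain ⟨f, rfl⟩ := (proj (essKernel F)).map_surjective f
    obtain ⟨g, rfl⟩ := (proj (essKernel F)).map_surjective g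
    rw [← Functor.map_add]
    exact F.map_add⟩
  have hfull : G.Full := ⟨fun {X Y} f => by
    obtain ⟨f, rfl⟩ := F.map_surjective f
    exact ⟨(proj (essKernel F)).map f, rfl⟩⟩
  have hess : G.EssSurj := ⟨fun Y =>
    ⟨(proj (essKernel F)).obj (F.objPreimage Y), ⟨F.objObjPreimageIso Y⟩⟩⟩
  have hfaith : G.Faithful := ⟨fun {X Y} f g hfg => by
    obtain ⟨f, rfl⟩ := (proj (essKernel F)).map_surjective f
    obtain ⟨g, rfl⟩ := (proj (essKernel F)).map_surjective g
    rw [proj_map_eq_iff]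
    apply hobj
    rw [F.map_sub, sub_eq_zero]
    exact hfg⟩
  have heq : G.IsEquivalence := { }
  refine ⟨essKernel F, inferInstance, G,
    ⟨fun X hX => h.projective_of_isZero hX, fun S hS => ?_⟩, hGF, hadd, heq, ?_, ?_⟩
  · exact IsKernelCokernelPair.of_map (F := G) (ED.isKernelCokernelPair _ (h.exact S hS))
  · rintro S ⟨T, hT, ⟨e⟩⟩
    exact ED.of_iso _ _ ⟨G.mapShortComplex.mapIso e⟩ (h.exact T hT)
  · intro S hS
    obtain ⟨T, hT, ⟨e⟩⟩ := FrobQuot.exists_map_conflation_iso hC h.exact h.map_projective hS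
    refine ⟨T, hT, ⟨?_⟩⟩
    -- Since `proj (essKernel F) ⋙ G` is `F`, the unit identifies the image of `T` in the factor
    -- category with `G.inv` applied to `T.map F`.
    exact (T.map (proj (essKernel F))).mapNatIso G.asEquivalence.unitIso ≪≫
      G.inv.mapShortComplex.mapIso e

end Functors

end FrobQuot

theorem theorem2
    {A : Type*} [Category* A] [Preadditive A] [HasFiniteBiproducts A]
    {B : Type*} [Category* B] [Preadditive B] [HasFiniteBiproducts B]
    (EA : FrobQuot.ExactStructure A) (hA : EA.IsFrobenius)
    (EB : FrobQuot.ExactStructure B) (hB : EB.IsFrobenius)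
    (F : A ⥤ B) [F.Additive] :
    FrobQuot.IsFrobeniusQuotient EA EB F ↔
      FrobQuot.IsPretriangleEquivalence EA EB F ∧ FrobQuot.IsObjective F ∧ F.Full ∧ F.EssSurj := by
  constructor
  · exact fun h => h.isPretriangleEquivalence hA
  · rintro ⟨h, hobj, _, _⟩
    exact h.isFrobeniusQuotient hA hobj
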